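/- Let $k$ be a perfect field, $A$ a $k$-algebra of finite type and $E$ a finitely generated $A$-module. Let $\tau_A(E)$ be the submodule of elements killed by a nonzerodivisor of $A$, and fix an injective $A$-linear map $E/\tau_A(E)\hookrightarrow F$ into a free $A$-module $F$ of finite rank $n$. For a surjection $\varphi:R\to A$ of $k$-algebras with $R$ of finite type over $k$ and $J=\ker\varphi$, a (torsion-free) $J$-deformation of $E$ to $R$ consists of a free $R$-module $\mathbf F$ of rank $n$, a $\varphi$-semilinear surjection $\pi:\mathbf F\to F$ with $\ker\pi=J\mathbf F$, and a finitely generated submodule $\mathbf E\subseteq\mathbf F$ with $J\mathbf F\subseteq\mathbf E$ and $\pi(\mathbf E)=E/\tau_A(E)$. Let $\mathcal R_R(\mathbf E)$ be the image of $\mathcal S_R(\mathbf E)\to\mathcal S_R(\mathbf F)$, where $\mathcal S$ denotes the symmetric algebra. The $R$-embedded Aluffi algebra of $E$ is the $A$-algebra $$\mathcal A_{R\to A}(E)=\mathcal S_A(E/\tau_A(E))\otimes_{\mathcal S_R(\mathbf E)}\mathcal R_R(\mathbf E).$$ Surjections $R\to R'$ of $k$-algebras over $A$, together with compatible semilinear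 maps $\mathbf F\to\mathbf F'$ over $F$ mapping $\mathbf E$ into $\mathbf E'$, induce $A$-algebra maps $\mathcal A_{R\to A}(E)\to\mathcal A_{R'\to A}(E)$. The absolute Aluffi algebra $\mathcal A_A(E)=\varprojlim\mathcal A_{R\to A}(E)$ is the inverse limit of the resulting system over all $k$-algebras $R$ of finite type with a surjection $R\to A$ of $k$-algebras and a $J$-deformation of $E$ to $R$. Theorem. Let $R\to A$ be a surjection of $k$-algebras with $R$ smooth of finite type over $k$, and let $\mathbf E\subseteq\mathbf F$ be a $J$-deformation of $E$ to $R$. Then: (a) the kernel of $\mathcal S_R(\mathbf E)\to\mathcal S_R(\mathbf F)$ is the $R$-torsion of $\mathcal S_R(\mathbf E)$, so that $\mathcal R_R(\mathbf E)$ is $\mathcal S_R(\mathbf E)$ modulo its $R$-torsion; (b) the structural map of $A$-algebras $\mathcal A_A(E)\to\mathcal A_{R\to A}(E)$ is an isomorphism; (c) the same holds if the inverse limit is taken over the smooth $k$-algebras of finite type only. -/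

import Mathlib

open scoped TensorProduct

universe u v w

noncomputable section

/-- The ring homomorphism `Sym_R M → Sym_{R'} M'` induced by a ring homomorphism `f : R → R'` and an
`f`-semilinear map `g : M → M'`. -/
def symMap {R R' M M' : Type*} [CommRing R] [CommRing R'] [AddCommGroup M] [Module R M]
    [AddCommGroup M'] [Module R' M'] (f : R →+* R') (g : M →ₛₗ[f] M') :
    SymmetricAlgebra R M →+* SymmetricAlgebra R' M' :=
  letI : Algebra R (SymmetricAlgebra R' M') :=
    ((algebraMap R' (SymmetricAlgebra R' M')).comp f).toAlgebra
  (SymmetricAlgebra.lift (R := R)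
    { toFun := fun m => SymmetricAlgebra.ι R' M' (g m)
      map_add' := fun x y => by simp
      map_smul' := fun r x => by
        rw [g.map_smulₛₗ, map_smul, Algebra.smul_def]
        exact (Algebra.smul_def (R := R) r (SymmetricAlgebra.ι R' M' (g x))).symm }).toRingHom

section symMap

variable {R R' R'' M M' M'' : Type*} [CommRing R] [CommRing R'] [CommRing R'']
  [AddCommGroup M] [Module R M] [AddCommGroup M'] [Module R' M'] [AddCommGroup M''] [Module R'' M'']

@[simp]
theorem symMap_ι (f : R →+* R') (g : M →ₛₗ[f] M') (m : M) :
    symMap f g (SymmetricAlgebra.ι R M m) = SymmetricAlgebra.ι R' M' (g m) := by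
  let _ : Algebra R (SymmetricAlgebra R' M') :=
    ((algebraMap R' (SymmetricAlgebra R' M')).comp f).toAlgebra
  exact SymmetricAlgebra.lift_ι_apply _ _

@[simp]
theorem symMap_algebraMap (f : R →+* R') (g : M →ₛₗ[f] M') (r : R) :
    symMap f g (algebraMap R _ r) = algebraMap R' _ (f r) := by
  let _ : Algebra R (SymmetricAlgebra R' M') :=
    ((algebraMap R' (SymmetricAlgebra R' M')).comp f).toAlgebra
  exact AlgHom.commutes (SymmetricAlgebra.lift (R := R) (A := SymmetricAlgebra R' M') _) r

/-- Two ring homomorphisms out of a symmetric algebra agree if they do so on scalars and on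
degree one. -/
theorem symRingHom_ext {B : Type*} [CommRing B] {p q : SymmetricAlgebra R M →+* B}
    (h₀ : ∀ r, p (algebraMap R _ r) = q (algebraMap R _ r))
    (h₁ : ∀ m, p (SymmetricAlgebra.ι R M m) = q (SymmetricAlgebra.ι R M m)) : p = q := by
  refine RingHom.ext fun x => ?_
  induction x using SymmetricAlgebra.induction with
  | algebraMap r => exact h₀ r
  | ι x => exact h₁ x
  | mul a b ha hb => rw [map_mul, map_mul, ha, hb]
  | add a b ha hb => rw [map_add, map_add, ha, hb]

end symMap

section Deformation

variable {A : Type u} [CommRing A] {E : Type v} [AddCommGroup E] [Module A E]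
  {F : Type w} [AddCommGroup F] [Module A F]

/-- A torsion-free `J`-deformation to `R` of the embedded module `emb : E/τ(E) ↪ F`, where
`J` is the kernel of the (surjective) ring homomorphism `φ : R → A`: a free `R`-module `amb` of the
same rank as `F` with a structural surjection `π : amb → F` compatible with `φ`
(`ker π = J • amb`), and a finitely generated submodule `sub` of `amb` which contains `J • amb` and
which `π` maps onto `E/τ(E) ⊆ F`. -/
structure Deformation {R : Type u} [CommRing R] (φ : R →+* A)
    (emb : (E ⧸ Submodule.torsion A E) →ₗ[A] F) where
  amb : Type u
  [addCommGroup : AddCommGroup amb]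
  [module : Module R amb]
  [free : Module.Free R amb]
  [finite : Module.Finite R amb]
  rank_eq : Module.finrank R amb = Module.finrank A F
  π : amb →ₛₗ[φ] F
  π_surjective : Function.Surjective π
  π_compatible : ∀ x, π x = 0 ↔ x ∈ RingHom.ker φ • (⊤ : Submodule R amb)
  sub : Submodule R amb
  sub_fg : sub.FG
  smul_le : RingHom.ker φ • (⊤ : Submodule R amb) ≤ sub
  image_sub : π '' (sub : Set amb) = Set.range emb

attribute [instance] Deformation.addCommGroup Deformation.module Deformation.free
  Deformation.finite

namespace Deformation

variable {R : Type u} [CommRing R] {φ : R →+* A} {emb : (E ⧸ Submodule.torsion A E) →ₗ[A] F}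

/-- The symmetric algebra `Sym_R(sub)` of the deformation. -/
abbrev Sym (D : Deformation φ emb) : Type u := SymmetricAlgebra R D.sub

/-- The kernel of the natural map `Sym_R(sub) → Sym_R(amb)`. -/
def reesIdeal (D : Deformation φ emb) : Ideal D.Sym :=
  RingHom.ker (symMap (RingHom.id R) D.sub.subtype)

/-- The Rees algebra of the embedded module `sub ⊆ amb`: the image of `Sym_R(sub) → Sym_R(amb)`,
as the residue algebra of `Sym_R(sub)` by the kernel of that map. -/
abbrev Rees (D : Deformation φ emb) : Type u := D.Sym ⧸ D.reesIdeal

theorem exists_preimage (D : Deformation φ emb) (x : D.sub) : ∃ e, emb e = D.π x := by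
  have h : D.π x ∈ D.π '' (D.sub : Set D.amb) := ⟨x, x.2, rfl⟩
  rw [D.image_sub] at h
  exact h

/-- The restriction of the structural surjection, as a `φ`-semilinear map `sub → E/τ(E)`. -/
def res (D : Deformation φ emb) (hemb : Function.Injective emb) :
    D.sub →ₛₗ[φ] (E ⧸ Submodule.torsion A E) where
  toFun x := (D.exists_preimage x).choose
  map_add' x y := hemb <| by
    rw [map_add, (D.exists_preimage _).choose_spec, (D.exists_preimage _).choose_spec,
      (D.exists_preimage _).choose_spec, Submodule.coe_add, map_add]
  map_smul' r x := hemb <| by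
    rw [map_smul, (D.exists_preimage _).choose_spec, (D.exists_preimage _).choose_spec,
      Submodule.coe_smul, LinearMap.map_smulₛₗ]

@[simp]
theorem emb_res (D : Deformation φ emb) (hemb : Function.Injective emb) (x : D.sub) :
    emb (D.res hemb x) = D.π x :=
  (D.exists_preimage x).choose_spec

/-- The map `Sym_R(sub) → Sym_A(E/τ(E))` induced by the structural surjection, as an algebra. -/
abbrev symAlgebra (D : Deformation φ emb) (hemb : Function.Injective emb) :
    Algebra D.Sym (SymmetricAlgebra A (E ⧸ Submodule.torsion A E)) :=
  (symMap φ (D.res hemb)).toAlgebra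

/-- The `R`-embedded Aluffi algebra `Sym_A(E/τ(E)) ⊗_{Sym_R(sub)} Rees_R(sub)`. -/
def EmbeddedAluffi (D : Deformation φ emb) (hemb : Function.Injective emb) : Type (max u v) :=
  letI := D.symAlgebra hemb
  SymmetricAlgebra A (E ⧸ Submodule.torsion A E) ⊗[D.Sym] D.Rees

variable (D : Deformation φ emb) (hemb : Function.Injective emb)

instance : CommRing (D.EmbeddedAluffi hemb) :=
  letI := D.symAlgebra hemb
  Algebra.TensorProduct.instCommRing (R := D.Sym)
    (A := SymmetricAlgebra A (E ⧸ Submodule.torsion A E)) (B := D.Rees)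

/-- The first coprojection `s ↦ s ⊗ 1`. -/
def inSym : SymmetricAlgebra A (E ⧸ Submodule.torsion A E) →+* D.EmbeddedAluffi hemb :=
  letI := D.symAlgebra hemb
  Algebra.TensorProduct.includeLeftRingHom
    (R := D.Sym) (A := SymmetricAlgebra A (E ⧸ Submodule.torsion A E)) (B := D.Rees)

/-- The second coprojection `ρ ↦ 1 ⊗ ρ`. -/
def inRees : D.Rees →+* D.EmbeddedAluffi hemb :=
  letI := D.symAlgebra hemb
  (Algebra.TensorProduct.includeRight (R := D.Sym)
    (A := SymmetricAlgebra A (E ⧸ Submodule.torsion A E)) (B := D.Rees)).toRingHom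

/-- The `A`-algebra structure through the degree-zero part of `Sym_A(E/τ(E))`. -/
instance : Algebra A (D.EmbeddedAluffi hemb) :=
  ((D.inSym hemb).comp (algebraMap A _)).toAlgebra

theorem inSym_symMap (x : D.Sym) :
    D.inSym hemb (symMap φ (D.res hemb) x) = D.inRees hemb (Ideal.Quotient.mk _ x) := by
  let _ := D.symAlgebra hemb
  exact Algebra.TensorProduct.algebraMap_apply' (R := D.Sym)
    (A := SymmetricAlgebra A (E ⧸ Submodule.torsion A E)) (B := D.Rees) x

/-- Ring homomorphisms out of the tensor product. -/
def liftAluffi {B : Type*} [CommRing B]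
    (p : SymmetricAlgebra A (E ⧸ Submodule.torsion A E) →+* B) (q : D.Rees →+* B)
    (h : ∀ x, p (symMap φ (D.res hemb) x) = q (Ideal.Quotient.mk _ x)) :
    D.EmbeddedAluffi hemb →+* B :=
  letI := D.symAlgebra hemb
  letI : Algebra D.Sym B := (p.comp (symMap φ (D.res hemb))).toAlgebra
  (Algebra.TensorProduct.lift (R := D.Sym) (S := D.Sym)
    (A := SymmetricAlgebra A (E ⧸ Submodule.torsion A E)) (B := D.Rees) (C := B)
    { p with commutes' := fun _ => rfl }
    { q with commutes' := fun x => (h x).symm }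
    (fun _ _ => Commute.all _ _)).toRingHom

@[simp]
theorem liftAluffi_inSym {B : Type*} [CommRing B]
    (p : SymmetricAlgebra A (E ⧸ Submodule.torsion A E) →+* B) (q : D.Rees →+* B)
    (h : ∀ x, p (symMap φ (D.res hemb) x) = q (Ideal.Quotient.mk _ x)) (s) :
    D.liftAluffi hemb p q h (D.inSym hemb s) = p s := by
  let _ := D.symAlgebra hemb
  let _ : Algebra D.Sym B := (p.comp (symMap φ (D.res hemb))).toAlgebra
  refine (Algebra.TensorProduct.lift_tmul (R := D.Sym) (S := D.Sym) _ _ _ s (1 : D.Rees)).trans ?_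
  exact (congrArg (p s * ·) (map_one q)).trans (mul_one _)

@[simp]
theorem liftAluffi_inRees {B : Type*} [CommRing B]
    (p : SymmetricAlgebra A (E ⧸ Submodule.torsion A E) →+* B) (q : D.Rees →+* B)
    (h : ∀ x, p (symMap φ (D.res hemb) x) = q (Ideal.Quotient.mk _ x)) (y) :
    D.liftAluffi hemb p q h (D.inRees hemb y) = q y := by
  let _ := D.symAlgebra hemb
  let _ : Algebra D.Sym B := (p.comp (symMap φ (D.res hemb))).toAlgebra
  refine (Algebra.TensorProduct.lift_tmul (R := D.Sym) (S := D.Sym) _ _ _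
    (1 : SymmetricAlgebra A (E ⧸ Submodule.torsion A E)) y).trans ?_
  exact (congrArg (· * q y) (map_one p)).trans (one_mul _)

end Deformation

/-- An ambient datum over the ground field `k`: a `k`-algebra `R` of finite type with a surjection
`φ : R → A` of `k`-algebras, and a torsion-free deformation of the embedded module to `R`. -/
structure Ambient (k : Type u) [Field k] [Algebra k A]
    (emb : (E ⧸ Submodule.torsion A E) →ₗ[A] F) where
  R : Type u
  [commRing : CommRing R]
  [algebra : Algebra k R]
  finiteType : Algebra.FiniteType k R
  φ : R →ₐ[k] A
  φ_surjective : Function.Surjective φ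
  D : Deformation (φ : R →+* A) emb

attribute [instance] Ambient.commRing Ambient.algebra

namespace Ambient

variable {k : Type u} [Field k] [Algebra k A] {emb : (E ⧸ Submodule.torsion A E) →ₗ[A] F}

/-- A morphism of the inverse system: a surjection `f : R → R'` of `k`-algebras over `A`, with an
`f`-semilinear map of the ambient free modules which commutes with the structural surjections onto
`F` and maps the first deformation into the second. -/
structure Hom (X Y : Ambient k emb) where
  f : X.R →ₐ[k] Y.R
  f_surjective : Function.Surjective f
  f_comp : ∀ r, Y.φ (f r) = X.φ r
  g : X.D.amb →ₛₗ[(f : X.R →+* Y.R)] Y.D.amb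
  g_comp : ∀ x, Y.D.π (g x) = X.D.π x
  g_mem : ∀ x ∈ X.D.sub, g x ∈ Y.D.sub

namespace Hom

variable {X Y : Ambient k emb} (t : Hom X Y)

/-- The induced map of deformations. -/
def subMap : X.D.sub →ₛₗ[(t.f : X.R →+* Y.R)] Y.D.sub where
  toFun x := ⟨t.g x, t.g_mem x x.2⟩
  map_add' x y := Subtype.ext (by simp)
  map_smul' r x := Subtype.ext (by simp [LinearMap.map_smulₛₗ])

theorem reesIdeal_le :
    X.D.reesIdeal ≤ Y.D.reesIdeal.comap (symMap (t.f : X.R →+* Y.R) t.subMap) := by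
  have key : (symMap (RingHom.id Y.R) Y.D.sub.subtype).comp
        (symMap (t.f : X.R →+* Y.R) t.subMap)
      = (symMap (t.f : X.R →+* Y.R) t.g).comp (symMap (RingHom.id X.R) X.D.sub.subtype) := by
    apply symRingHom_ext
    · intro r; simp
    · intro m; simp [subMap]
  intro x hx
  have hx' : symMap (RingHom.id X.R) X.D.sub.subtype x = 0 := hx
  change symMap (RingHom.id Y.R) Y.D.sub.subtype (symMap (t.f : X.R →+* Y.R) t.subMap x) = 0
  have := RingHom.congr_fun key x
  simp only [RingHom.comp_apply] at this
  rw [this, hx', map_zero]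

/-- The induced map of Rees algebras. -/
def reesMap : X.D.Rees →+* Y.D.Rees :=
  Ideal.quotientMap _ (symMap (t.f : X.R →+* Y.R) t.subMap) t.reesIdeal_le

theorem symMap_res_subMap (hemb : Function.Injective emb) (x : X.D.Sym) :
    symMap (Y.φ : Y.R →+* A) (Y.D.res hemb) (symMap (t.f : X.R →+* Y.R) t.subMap x)
      = symMap (X.φ : X.R →+* A) (X.D.res hemb) x := by
  have key : (symMap (Y.φ : Y.R →+* A) (Y.D.res hemb)).comp
        (symMap (t.f : X.R →+* Y.R) t.subMap)
      = symMap (X.φ : X.R →+* A) (X.D.res hemb) := by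
    apply symRingHom_ext
    · intro r; simp [t.f_comp]
    · intro m
      have : Y.D.res hemb (t.subMap m) = X.D.res hemb m := hemb (by simp [subMap, t.g_comp])
      simp [this]
  exact RingHom.congr_fun key x

/-- The transition map of embedded Aluffi algebras, `s ⊗ ρ ↦ s ⊗ ρ'` with `ρ'` the image of `ρ`
under the induced map of Rees algebras. -/
def aluffiMap (hemb : Function.Injective emb) :
    X.D.EmbeddedAluffi hemb →ₐ[A] Y.D.EmbeddedAluffi hemb where
  __ := X.D.liftAluffi hemb (Y.D.inSym hemb) ((Y.D.inRees hemb).comp t.reesMap) (fun x => by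
    rw [← t.symMap_res_subMap hemb, Y.D.inSym_symMap hemb]
    rfl)
  commutes' a := X.D.liftAluffi_inSym hemb _ _ _ (algebraMap A _ a)

end Hom

/-- The inverse limit of the embedded Aluffi algebras over the full subsystem of those ambient data
which satisfy `P`: compatible families, as a subalgebra of the product. -/
def limitAluffi (hemb : Function.Injective emb) (P : Ambient k emb → Prop) :
    Subalgebra A (∀ X : {X : Ambient k emb // P X}, X.1.D.EmbeddedAluffi hemb) where
  carrier := {a | ∀ (X Y : {X : Ambient k emb // P X}) (t : Hom X.1 Y.1),
    t.aluffiMap hemb (a X) = a Y}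
  mul_mem' ha hb X Y t := by simp [ha X Y t, hb X Y t]
  add_mem' ha hb X Y t := by simp [ha X Y t, hb X Y t]
  algebraMap_mem' r X Y t := by simp

/-- The structural map from the inverse limit to its member at `X`. -/
def limitAluffi.proj (hemb : Function.Injective emb) (P : Ambient k emb → Prop)
    (X : Ambient k emb) (hX : P X) : limitAluffi hemb P →ₐ[A] X.D.EmbeddedAluffi hemb :=
  (Pi.evalAlgHom A (fun X : {X : Ambient k emb // P X} => X.1.D.EmbeddedAluffi hemb) ⟨X, hX⟩).comp
    (limitAluffi hemb P).val

end Ambient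

end Deformation

end

/-! For (a), a smooth algebra over a field is reduced and Noetherian, so its total ring of fractions
Q is semisimple. The map from `sub` to Q ⊗ Sym(`sub`) therefore extends to `amb`, and localization
of Sym(`sub`) factors through Sym(`amb`): the kernel of Sym(`sub`) → Sym(`amb`) is torsion.
Conversely Sym(`amb`) is free, so torsion dies in it.

For (b) and (c), every embedded Aluffi algebra is the quotient of the one ring Sym_A(E/τ(E)) by the
image of the Rees equations, so all transition maps are surjective. Given X smooth and Y arbitrary,
a polynomial ring Z over A maps onto both. It then suffices that Z → X is injective on Aluffi
algebras: the component at Y is determined by that at Z, hence by that at X, and constant families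
give surjectivity.

Injectivity means that an equation s of X has the same image in Sym_A(E/τ(E)) as some equation of Z
(`exists_mem_reesIdeal`). Let I be the kernel from Z to X. Formal smoothness gives a section of
Z/I^(N+1) → X for every N. Lifting the coefficients of s along it yields an element of polynomial
degree ≤ N (`exists_lift_sym`) whose polynomial has all coefficients in I^(N+1). Such a polynomial
also comes from an element that vanishes in Sym_A(E/τ(E)) (`exists_toPoly_eq`); the difference of
the two is the required equation. -/

noncomputable section

/-! ### Reducedness and semisimple total rings of fractions. -/

section Reduced

/-- A smooth algebra over a field is reduced. -/
theorem isReduced_of_smooth_of_field (k R : Type*) [Field k] [CommRing R] [Algebra k R]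
    [Algebra.Smooth k R] : IsReduced R := by
  refine ⟨fun x hx => ?_⟩
  by_contra hne
  -- The annihilator of `x` is proper, so it lies in a maximal ideal `m`; it suffices that `x` dies
  -- in a neighbourhood of `m`.
  obtain ⟨m, hm, hle⟩ := Ideal.exists_le_maximal (LinearMap.ker (LinearMap.toSpanSingleton R R x))
    (fun h => hne (by simpa using (Ideal.eq_top_iff_one _).mp h))
  obtain ⟨f, hfm, n, _, _, _⟩ :=
    Algebra.IsSmoothAt.exists_isStandardEtale_mvPolynomial (R := k) (p := m)
  let P := MvPolynomial (Fin n) k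
  let Q := FractionRing P
  -- Near `m` the algebra is étale over an affine space: its generic fibre is unramified over a
  -- field, hence reduced, and by flatness it embeds in that fibre.
  have hred : IsReduced (Q ⊗[P] Localization.Away f) :=
    Algebra.FormallyUnramified.isReduced_of_field Q _
  have hinj : Function.Injective (Algebra.TensorProduct.includeRight :
      Localization.Away f →ₐ[P] Q ⊗[P] Localization.Away f) :=
    Algebra.TensorProduct.includeRight_injective (IsFractionRing.injective P Q)
  have hred' : IsReduced (Localization.Away f) := isReduced_of_injective _ hinj
  have h0 : algebraMap R (Localization.Away f) x = 0 := (hx.map _).eq_zero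
  obtain ⟨⟨_, j, rfl⟩, hs⟩ := (IsLocalization.map_eq_zero_iff (Submonoid.powers f) _ x).mp h0
  exact hfm (hm.isPrime.mem_of_pow_mem j (hle (by simpa using hs)))

/-- The total ring of fractions of a reduced Noetherian ring is semisimple. -/
theorem isSemisimpleRing_fractionRing (R : Type*) [CommRing R] [IsReduced R] [IsNoetherianRing R] :
    IsSemisimpleRing (FractionRing R) := by
  have : IsNoetherianRing (FractionRing R) :=
    IsLocalization.isNoetherianRing (nonZeroDivisors R) _ inferInstance
  have hdim : Ring.KrullDimLE 0 (FractionRing R) := by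
    -- A prime of the total ring of fractions contracts to a set of zero divisors, that is, into the
    -- union of the finitely many minimal primes; prime avoidance puts it in one of them.
    have key (J : Ideal (FractionRing R)) (hJ : J.IsPrime) :
        J.comap (algebraMap R (FractionRing R)) ∈ minimalPrimes R := by
      have hsub : (J.comap (algebraMap R (FractionRing R)) : Set R) ⊆
          ⋃ p ∈ minimalPrimes R, ((id p : Ideal R) : Set R) := by
        intro x hx
        have hx' : x ∉ nonZeroDivisors R := fun h =>
          hJ.ne_top (J.eq_top_of_isUnit_mem hx (IsLocalization.map_units (FractionRing R) ⟨x, h⟩))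
        rw [mem_nonZeroDivisors_iff_right] at hx'
        push Not at hx'
        obtain ⟨y, hy, hy0⟩ := hx'
        have hrad : (⊥ : Ideal R).radical = ⊥ := nilradical_eq_zero R
        change x ∈ ⋃ p ∈ (⊥ : Ideal R).minimalPrimes, (p : Set R)
        rw [Ideal.iUnion_minimalPrimes]
        refine ⟨y, ?_, ?_⟩
        · rwa [hrad]
        · rw [hrad, Ideal.mem_bot, mul_comm, hy]
      obtain ⟨p, hp, hle⟩ := (Ideal.subset_union_prime_finite
        (minimalPrimes.finite_of_isNoetherianRing R) (f := id) 0 0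
        (fun p hp _ _ => hp.1.1)).mp hsub
      have hprime := hJ.comap (algebraMap R (FractionRing R))
      rwa [le_antisymm hle (hp.2 ⟨hprime, bot_le⟩ hle)]
    refine Ring.krullDimLE_zero_iff.mpr fun J hJ => ?_
    obtain ⟨m, hm, hle⟩ := Ideal.exists_le_maximal J hJ.ne_top
    have hunder : m.under R = J.under R :=
      le_antisymm ((key m hm.isPrime).2 (key J hJ).1 (Ideal.comap_mono hle)) (Ideal.comap_mono hle)
    have : m = J := by
      rw [← IsLocalization.map_under (nonZeroDivisors R) (FractionRing R) m, hunder,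
        IsLocalization.map_under (nonZeroDivisors R) (FractionRing R) J]
    exact this ▸ hm
  have : IsArtinianRing (FractionRing R) :=
    isArtinianRing_iff_isNoetherianRing_krullDimLE_zero.mpr ⟨inferInstance, hdim⟩
  exact IsArtinianRing.isSemisimpleRing_of_isReduced _

/-- Over a reduced Noetherian ring, linear maps into modules over the total ring of fractions
extend from submodules. -/
theorem exists_extend_fractionRing {R M L : Type*} [CommRing R] [IsReduced R] [IsNoetherianRing R]
    [AddCommGroup M] [Module R M] [AddCommGroup L] [Module R L] [Module (FractionRing R) L]
    [IsScalarTower R (FractionRing R) L] (N : Submodule R M) (f : N →ₗ[R] L) :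
    ∃ g : M →ₗ[R] L, g ∘ₗ N.subtype = f := by
  have := isSemisimpleRing_fractionRing R
  -- By flatness the base change of `N` is still a submodule of that of `M`, and over a semisimple
  -- ring it is a direct summand.
  obtain ⟨h, hh⟩ := IsSemisimpleModule.extension_property
    (N.subtype.baseChange (FractionRing R))
    (Module.Flat.lTensor_preserves_injective_linearMap N.subtype N.subtype_injective)
    (f.liftBaseChange (FractionRing R))
  refine ⟨h.restrictScalars R ∘ₗ TensorProduct.mk R (FractionRing R) M 1, ?_⟩
  ext x
  simpa using LinearMap.congr_fun hh (1 ⊗ₜ x)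

end Reduced

/-! ### The kernel of Sym N → Sym M and torsion. -/

section SymTorsion

variable {R M : Type*} [CommRing R] [AddCommGroup M] [Module R M]

/-- The kernel of `Sym N → Sym M` is torsion for `N` a submodule of `M` over a reduced Noetherian
ring. -/
theorem ker_symMap_subtype_le_torsion [IsReduced R] [IsNoetherianRing R] (N : Submodule R M)
    (t : SymmetricAlgebra R N) (ht : symMap (RingHom.id R) N.subtype t = 0) :
    t ∈ Submodule.torsion R (SymmetricAlgebra R N) := by
  obtain ⟨g, hg⟩ := exists_extend_fractionRing N
    (TensorProduct.mk R (FractionRing R) (SymmetricAlgebra R N) 1 ∘ₗ SymmetricAlgebra.ι R N)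
  -- The extension `g` makes the localization map of Sym N factor through Sym M.
  have hcomp : ((SymmetricAlgebra.lift g).toRingHom).comp (symMap (RingHom.id R) N.subtype)
      = (Algebra.TensorProduct.includeRight :
        SymmetricAlgebra R N →ₐ[R] FractionRing R ⊗[R] SymmetricAlgebra R N).toRingHom := by
    apply symRingHom_ext
    · intro r
      simp
    · intro m
      simpa using LinearMap.congr_fun hg m
  have h0 : TensorProduct.mk R (FractionRing R) (SymmetricAlgebra R N) 1 t = 0 := by
    have := RingHom.congr_fun hcomp t
    rw [RingHom.comp_apply, ht, map_zero] at this
    exact this.symm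
  obtain ⟨s, hs⟩ := (IsLocalizedModule.eq_zero_iff (nonZeroDivisors R)
    (TensorProduct.mk R (FractionRing R) (SymmetricAlgebra R N) 1)).mp h0
  exact (Submodule.mem_torsion_iff t).mpr ⟨s, hs⟩

/-- Torsion dies in the symmetric algebra of a free module. -/
theorem symMap_subtype_eq_zero_of_mem_torsion [Module.Free R M] (N : Submodule R M)
    (t : SymmetricAlgebra R N) (ht : t ∈ Submodule.torsion R (SymmetricAlgebra R N)) :
    symMap (RingHom.id R) N.subtype t = 0 := by
  obtain ⟨s, hs⟩ := (Submodule.mem_torsion_iff t).mp ht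
  let b := (Module.Free.chooseBasis R M).symmetricAlgebra
  have hs' : (s : R) • symMap (RingHom.id R) N.subtype t = 0 := by
    have := congrArg (symMap (RingHom.id R) N.subtype) hs
    rwa [Submonoid.smul_def, Algebra.smul_def, map_mul, symMap_algebraMap, map_zero,
      RingHom.id_apply, ← Algebra.smul_def] at this
  refine b.ext_elem fun i => ?_
  have := congrArg (fun y => b.repr y i) hs'
  simp only [map_smul, Finsupp.smul_apply, smul_eq_mul, map_zero, Finsupp.zero_apply] at this ⊢
  exact (mem_nonZeroDivisors_iff_left.mp s.2) _ this

end SymTorsion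
end

noncomputable section

/-! ### Polynomials with coefficients in powers of an ideal. -/

namespace Deformation

variable {A : Type u} [CommRing A] {E : Type v} [AddCommGroup E] [Module A E]
  {F : Type w} [AddCommGroup F] [Module A F]
  {R : Type u} [CommRing R] {φ : R →+* A} {emb : (E ⧸ Submodule.torsion A E) →ₗ[A] F}
  (D : Deformation φ emb)

/-- The submodule of a deformation is the full preimage of the embedded module. -/
theorem mem_sub_iff (x : D.amb) : x ∈ D.sub ↔ D.π x ∈ Set.range emb := by
  rw [← D.image_sub]
  refine ⟨fun h => ⟨x, h, rfl⟩, ?_⟩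
  rintro ⟨y, hy, hyx⟩
  have : x - y ∈ D.sub := D.smul_le ((D.π_compatible _).mp (by rw [map_sub, hyx, sub_self]))
  simpa using add_mem this hy

variable {ι : Type*} (b : Module.Basis ι R D.amb)

/-- The natural map `Sym_R(sub) → Sym_R(amb)` in terms of a basis of `amb`. -/
def toPoly : D.Sym →+* MvPolynomial ι R :=
  (SymmetricAlgebra.equivMvPolynomial b).toRingEquiv.toRingHom.comp
    (symMap (RingHom.id R) D.sub.subtype)

theorem mem_reesIdeal_iff (s : D.Sym) : s ∈ D.reesIdeal ↔ D.toPoly b s = 0 :=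
  (EmbeddingLike.map_eq_zero_iff (f := (SymmetricAlgebra.equivMvPolynomial b).toRingEquiv)).symm

@[simp]
theorem toPoly_algebraMap (r : R) : D.toPoly b (algebraMap R _ r) = MvPolynomial.C r := by
  simp [toPoly, MvPolynomial.algebraMap_eq]

theorem toPoly_ι [Fintype ι] (x : D.sub) : D.toPoly b (SymmetricAlgebra.ι R _ x) =
    ∑ i, MvPolynomial.C (b.repr x i) * MvPolynomial.X i := by
  have : D.toPoly b (SymmetricAlgebra.ι R _ x) =
      SymmetricAlgebra.equivMvPolynomial b (SymmetricAlgebra.ι R D.amb x) := by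
    simp [toPoly]
  rw [this, ← congrArg (fun y => SymmetricAlgebra.equivMvPolynomial b (SymmetricAlgebra.ι R D.amb y))
    (b.sum_repr (x : D.amb))]
  simp only [map_sum, map_smul, SymmetricAlgebra.equivMvPolynomial_ι_apply,
    MvPolynomial.smul_eq_C_mul]

theorem toPoly_ι_smul_basis (r : R) (i : ι) (h : r • b i ∈ D.sub) :
    D.toPoly b (SymmetricAlgebra.ι R _ ⟨r • b i, h⟩) =
      MvPolynomial.C r * MvPolynomial.X i := by
  simp [toPoly, Algebra.smul_def, MvPolynomial.algebraMap_eq]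

variable (hemb : Function.Injective emb)

/-- Since I·`amb` ⊆ `sub`, each of the |α| variables can absorb one factor from I and become an
element of `sub`. The extra factor, the +1 in the exponent, stays in degree zero, where `φ` kills
it. -/
theorem exists_toPoly_eq_monomial {I : Ideal R} (hI : I ≤ RingHom.ker φ) (α : ι →₀ ℕ) {a : R}
    (ha : a ∈ I ^ (α.degree + 1)) :
    ∃ s : D.Sym, D.toPoly b s = MvPolynomial.monomial α a ∧ symMap φ (D.res hemb) s = 0 := by
  obtain ⟨d, hd⟩ : ∃ d, α.degree = d := ⟨_, rfl⟩
  induction d generalizing α a with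
  | zero =>
    obtain rfl := (Finsupp.degree_eq_zero_iff α).mp hd
    refine ⟨algebraMap R _ a, by simp, ?_⟩
    rw [symMap_algebraMap, show φ a = 0 from hI (by simpa using ha), map_zero]
  | succ d ih =>
    obtain ⟨i, hi⟩ : ∃ i, α i ≠ 0 := by
      by_contra! h
      have : α = 0 := Finsupp.ext h
      simp [this] at hd
    obtain ⟨β, rfl⟩ : ∃ β, α = Finsupp.single i 1 + β :=
      le_iff_exists_add.mp (Finsupp.single_le_iff.mpr (Nat.one_le_iff_ne_zero.mpr hi))
    have hβ : β.degree = d := by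
      rw [map_add, Finsupp.degree_single] at hd
      omega
    rw [hd, pow_succ' I (d + 1)] at ha
    induction ha using Submodule.mul_induction_on' with
    | mem_mul_mem x hx y hy =>
      obtain ⟨s, hs, hs'⟩ := ih β (by rwa [hβ]) hβ
      have hmem : x • b i ∈ D.sub :=
        D.smul_le (Submodule.smul_mem_smul (hI hx) Submodule.mem_top)
      -- One factor `x` is spent on the variable `i`; the product vanishes in Sym_A(E/τ(E)) because
      -- `s` already does.
      refine ⟨SymmetricAlgebra.ι R _ ⟨x • b i, hmem⟩ * s, ?_, by rw [map_mul, hs', mul_zero]⟩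
      rw [map_mul, hs, toPoly_ι_smul_basis, MvPolynomial.C_mul_X_eq_monomial,
        MvPolynomial.monomial_mul]
    | add x _ y _ hx hy =>
      obtain ⟨s, hs, hs'⟩ := hx
      obtain ⟨s₁, hs₁, hs₁'⟩ := hy
      exact ⟨s + s₁, by rw [map_add, hs, hs₁, map_add], by rw [map_add, hs', hs₁', add_zero]⟩

/-- Each monomial has degree less than m, so I^m lies in the power of I that
`exists_toPoly_eq_monomial` needs. -/
theorem exists_toPoly_eq {I : Ideal R} (hI : I ≤ RingHom.ker φ) {m : ℕ}
    (p : MvPolynomial ι R) (hp : p.totalDegree < m) (hpI : ∀ α, p.coeff α ∈ I ^ m) :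
    ∃ s : D.Sym, D.toPoly b s = p ∧ symMap φ (D.res hemb) s = 0 := by
  have key (α : ι →₀ ℕ) : ∃ s : D.Sym, D.toPoly b s = MvPolynomial.monomial α (p.coeff α) ∧
      symMap φ (D.res hemb) s = 0 := by
    by_cases h : α ∈ p.support
    · refine D.exists_toPoly_eq_monomial b hemb hI α (Ideal.pow_le_pow_right ?_ (hpI α))
      have : α.degree ≤ p.totalDegree := MvPolynomial.le_totalDegree h
      omega
    · rw [MvPolynomial.notMem_support_iff.mp h]
      exact ⟨0, by simp, by simp⟩
  choose s hs hs' using key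
  refine ⟨∑ α ∈ p.support, s α, ?_, ?_⟩
  · rw [map_sum, Finset.sum_congr rfl fun α _ => hs α, MvPolynomial.support_sum_monomial_coeff]
  · rw [map_sum, Finset.sum_eq_zero fun α _ => hs' α]

end Deformation

/-! ### Lifting Rees equations along a morphism. -/

namespace Ambient

variable {A : Type u} [CommRing A] {E : Type v} [AddCommGroup E] [Module A E]
  {F : Type w} [AddCommGroup F] [Module A F]
  {k : Type u} [Field k] [Algebra k A] {emb : (E ⧸ Submodule.torsion A E) →ₗ[A] F}

namespace Hom

variable {Z X : Ambient k emb} (t : Hom Z X) {ι : Type*} [Fintype ι]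
  (b : Module.Basis ι Z.R Z.D.amb) (c : Module.Basis ι X.R X.D.amb)

theorem g_sum_smul_basis (hbc : ∀ i, t.g (b i) = c i) (a : ι → Z.R) :
    t.g (∑ i, a i • b i) = ∑ i, t.f (a i) • c i := by
  simp [map_sum, LinearMap.map_smulₛₗ, hbc]

/-- Elements of the symmetric algebra of a deformation lift along a morphism of ambient data,
with bounded degree, compatibly with a section of the morphism modulo a power of its kernel. -/
theorem exists_lift_sym (hemb : Function.Injective emb) (hbc : ∀ i, t.g (b i) = c i)
    (s : X.D.Sym) :
    -- The bound `N` precedes `J` and `σ`, so that `J` can later be a power depending on `N`.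
    ∃ N : ℕ, ∀ (J : Ideal Z.R) (σ : X.R →+* Z.R ⧸ J),
      (∀ r q, Ideal.Quotient.mk J q = σ r → t.f q = r) →
      ∃ s' : Z.D.Sym, (Z.D.toPoly b s').totalDegree ≤ N ∧
        MvPolynomial.map (Ideal.Quotient.mk J) (Z.D.toPoly b s') =
          MvPolynomial.map σ (X.D.toPoly c s) ∧
        symMap (Z.φ : Z.R →+* A) (Z.D.res hemb) s' =
          symMap (X.φ : X.R →+* A) (X.D.res hemb) s := by
  induction s using SymmetricAlgebra.induction with
  | algebraMap r =>
    refine ⟨0, fun J σ hσ => ?_⟩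
    obtain ⟨q, hq⟩ := Ideal.Quotient.mk_surjective (σ r)
    refine ⟨algebraMap Z.R _ q, by simp, by simp [hq], ?_⟩
    rw [symMap_algebraMap, symMap_algebraMap]
    simp [← hσ r q hq, t.f_comp]
  | ι x =>
    refine ⟨1, fun J σ hσ => ?_⟩
    choose q hq using fun i => Ideal.Quotient.mk_surjective (I := J) (σ (c.repr (x : X.D.amb) i))
    have hg : t.g (∑ i, q i • b i) = x := by
      rw [t.g_sum_smul_basis b c hbc]
      simp only [hσ _ _ (hq _)]
      exact c.sum_repr _
    -- Any lift of an element of `sub` lies in `sub`, because `sub` is the full preimage of E/τ(E).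
    have hmem : ∑ i, q i • b i ∈ Z.D.sub := by
      rw [Z.D.mem_sub_iff, ← t.g_comp, hg, ← X.D.mem_sub_iff]
      exact x.2
    have hrepr (i : ι) : b.repr (∑ j, q j • b j) i = q i := by
      rw [b.repr_sum_self]
    refine ⟨SymmetricAlgebra.ι Z.R _ ⟨_, hmem⟩, ?_, ?_, ?_⟩
    · rw [Z.D.toPoly_ι b]
      simp only [hrepr]
      refine MvPolynomial.totalDegree_finsetSum_le fun i _ => ?_
      rw [MvPolynomial.C_mul_X_eq_monomial]
      exact (MvPolynomial.totalDegree_monomial_le _ _).trans (by simp)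
    · rw [Z.D.toPoly_ι b, X.D.toPoly_ι c]
      simp only [hrepr]
      simp only [map_sum, map_mul, MvPolynomial.map_C, MvPolynomial.map_X, hq]
    · rw [symMap_ι, symMap_ι]
      congr 1
      apply hemb
      rw [Deformation.emb_res, Deformation.emb_res, ← hg, t.g_comp]
  | mul s₁ s₂ h₁ h₂ =>
    obtain ⟨N₁, h₁⟩ := h₁
    obtain ⟨N₂, h₂⟩ := h₂
    refine ⟨N₁ + N₂, fun J σ hσ => ?_⟩
    obtain ⟨u₁, hd₁, hm₁, hs₁⟩ := h₁ J σ hσ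
    obtain ⟨u₂, hd₂, hm₂, hs₂⟩ := h₂ J σ hσ
    refine ⟨u₁ * u₂, ?_, by simp only [map_mul, hm₁, hm₂], by rw [map_mul, hs₁, hs₂, map_mul]⟩
    rw [map_mul]
    exact (MvPolynomial.totalDegree_mul _ _).trans (add_le_add hd₁ hd₂)
  | add s₁ s₂ h₁ h₂ =>
    obtain ⟨N₁, h₁⟩ := h₁
    obtain ⟨N₂, h₂⟩ := h₂
    refine ⟨max N₁ N₂, fun J σ hσ => ?_⟩
    obtain ⟨u₁, hd₁, hm₁, hs₁⟩ := h₁ J σ hσ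
    obtain ⟨u₂, hd₂, hm₂, hs₂⟩ := h₂ J σ hσ
    refine ⟨u₁ + u₂, ?_, by simp only [map_add, hm₁, hm₂], by rw [map_add, hs₁, hs₂, map_add]⟩
    rw [map_add]
    exact (MvPolynomial.totalDegree_add _ _).trans (max_le_max hd₁ hd₂)

/-- The equations of the Rees algebra of a formally smooth ambient datum lift along a morphism
which maps a basis to a basis. -/
theorem exists_mem_reesIdeal [Algebra.FormallySmooth k X.R] (hemb : Function.Injective emb)
    (hbc : ∀ i, t.g (b i) = c i) {s : X.D.Sym} (hs : s ∈ X.D.reesIdeal) :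
    ∃ s' ∈ Z.D.reesIdeal, symMap (Z.φ : Z.R →+* A) (Z.D.res hemb) s' =
      symMap (X.φ : X.R →+* A) (X.D.res hemb) s := by
  obtain ⟨N, hN⟩ := t.exists_lift_sym b c hemb hbc s
  let I : Ideal Z.R := RingHom.ker t.f
  have hI : I ≤ RingHom.ker (Z.φ : Z.R →+* A) := fun r (hr : t.f r = 0) => by
    have := t.f_comp r
    rw [hr, map_zero] at this
    exact this.symm
  let τ : (Z.R ⧸ I ^ (N + 1)) →ₐ[k] X.R := Ideal.Quotient.liftₐ _ t.f fun r hr =>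
    Ideal.pow_le_self (Nat.succ_ne_zero N) hr
  have hτ (r : Z.R) : τ (Ideal.Quotient.mk _ r) = t.f r := rfl
  have hτs : Function.Surjective τ := fun r => by
    obtain ⟨q, hq⟩ := t.f_surjective r
    exact ⟨Ideal.Quotient.mk _ q, hq⟩
  -- The kernel of `τ` is I/I^(N+1), whose power N+1 is zero; formal smoothness then lifts the
  -- identity to a section `σ`.
  have hnil : IsNilpotent (RingHom.ker (τ : (Z.R ⧸ I ^ (N + 1)) →+* X.R)) := by
    refine ⟨N + 1, ?_⟩
    have : RingHom.ker (τ : (Z.R ⧸ I ^ (N + 1)) →+* X.R) = I.map (Ideal.Quotient.mk _) := by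
      ext x
      obtain ⟨q, rfl⟩ := Ideal.Quotient.mk_surjective x
      refine ⟨fun h => Ideal.mem_map_of_mem _ h, fun h => ?_⟩
      have hle : I.map (Ideal.Quotient.mk (I ^ (N + 1))) ≤
          RingHom.ker (τ : (Z.R ⧸ I ^ (N + 1)) →+* X.R) :=
        Ideal.map_le_iff_le_comap.mpr fun r hr => hr
      exact hle h
    rw [this, ← Ideal.map_pow, Ideal.map_quotient_self]
    rfl
  let σ := Algebra.FormallySmooth.liftOfSurjective (AlgHom.id k X.R) τ hτs hnil
  have hσ (r : X.R) : τ (σ r) = r :=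
    Algebra.FormallySmooth.liftOfSurjective_apply (AlgHom.id k X.R) τ hτs hnil r
  obtain ⟨u, hd, hm, hu⟩ := hN _ (σ : X.R →+* Z.R ⧸ I ^ (N + 1)) fun r q hq => by
    rw [← hτ, hq]
    exact hσ r
  rw [(X.D.mem_reesIdeal_iff c s).mp hs, map_zero] at hm
  obtain ⟨v, hv, hv'⟩ := Z.D.exists_toPoly_eq b hemb hI (Z.D.toPoly b u) (Nat.lt_succ_of_le hd)
    fun α => by
      rw [← Ideal.Quotient.eq_zero_iff_mem, ← MvPolynomial.coeff_map, hm, MvPolynomial.coeff_zero]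
  -- `u` and `v` have the same polynomial, while `v` is zero in Sym_A(E/τ(E)).
  refine ⟨u - v, (Z.D.mem_reesIdeal_iff b _).mpr ?_, ?_⟩
  · rw [map_sub, hv, sub_self]
  · rw [map_sub, hv', sub_zero, hu]

end Hom
end Ambient
end

/-! ### Aluffi algebras as quotients of Sym_A(E/τ(E)), and pullback of deformations. -/

noncomputable section

/-- The semilinear map out of a standard free module with prescribed values on the standard
basis. -/
def piSemilinear {R R' M ι : Type*} [CommRing R] [CommRing R'] [AddCommGroup M] [Module R' M]
    [Fintype ι] (f : R →+* R') (v : ι → M) : (ι → R) →ₛₗ[f] M where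
  toFun a := ∑ i, f (a i) • v i
  map_add' a a' := by simp [add_smul, Finset.sum_add_distrib]
  map_smul' r a := by simp [mul_smul, Finset.smul_sum]

theorem piSemilinear_apply {R R' M ι : Type*} [CommRing R] [CommRing R'] [AddCommGroup M]
    [Module R' M] [Fintype ι] (f : R →+* R') (v : ι → M) (a : ι → R) :
    piSemilinear f v a = ∑ i, f (a i) • v i := rfl

theorem piSemilinear_basisFun {R R' M ι : Type*} [CommRing R] [CommRing R'] [AddCommGroup M]
    [Module R' M] [Fintype ι] (f : R →+* R') (v : ι → M) (i : ι) :
    piSemilinear f v (Pi.basisFun R ι i) = v i := by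
  classical
  simp [piSemilinear_apply, Pi.single_apply, apply_ite f]

theorem Module.Basis.mem_ideal_smul_top_iff {R M ι : Type*} [CommRing R] [AddCommGroup M]
    [Module R M] [Fintype ι] (b : Module.Basis ι R M) (I : Ideal R) (x : M) :
    x ∈ I • (⊤ : Submodule R M) ↔ ∀ i, b.repr x i ∈ I := by
  refine ⟨fun h i => ?_, fun h => ?_⟩
  · induction h using Submodule.smul_induction_on' with
    | smul r hr n _ => simpa using I.mul_mem_right _ hr
    | add x _ y _ hx hy => simpa using add_mem hx hy
  · rw [← b.sum_repr x]
    exact sum_mem fun i _ => Submodule.smul_mem_smul (h i) Submodule.mem_top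

namespace Deformation

variable {A : Type u} [CommRing A] {E : Type v} [AddCommGroup E] [Module A E]
  {F : Type w} [AddCommGroup F] [Module A F]
  {R : Type u} [CommRing R] {φ : R →+* A} {emb : (E ⧸ Submodule.torsion A E) →ₗ[A] F}
  (D : Deformation φ emb) (hemb : Function.Injective emb)

/-- The Rees algebra is a quotient of Sym_R(`sub`), so its elements can be moved across the tensor
sign. -/
theorem inSym_surjective : Function.Surjective (D.inSym hemb) := by
  let _ := D.symAlgebra hemb
  intro z
  have h (z : SymmetricAlgebra A (E ⧸ Submodule.torsion A E) ⊗[D.Sym] D.Rees) :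
      ∃ s : SymmetricAlgebra A (E ⧸ Submodule.torsion A E), s ⊗ₜ[D.Sym] (1 : D.Rees) = z := by
    induction z with
    | zero => exact ⟨0, TensorProduct.zero_tmul _ _⟩
    | tmul s y =>
      obtain ⟨y, rfl⟩ := Ideal.Quotient.mk_surjective y
      refine ⟨y • s, ?_⟩
      rw [TensorProduct.smul_tmul]
      congr 1
      exact (Algebra.smul_def y (1 : D.Rees)).trans (mul_one _)
    | add x y hx hy =>
      obtain ⟨s, rfl⟩ := hx
      obtain ⟨s', rfl⟩ := hy
      exact ⟨s + s', TensorProduct.add_tmul _ _ _⟩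
  exact h z

/-- The embedded Aluffi algebra is the quotient of `Sym_A(E/τ(E))` by the image of the equations of
the Rees algebra. -/
theorem exists_hom_inSym {B : Type*} [CommRing B]
    (p : SymmetricAlgebra A (E ⧸ Submodule.torsion A E) →+* B)
    (h : ∀ s ∈ D.reesIdeal, p (symMap φ (D.res hemb) s) = 0) :
    ∃ ψ : D.EmbeddedAluffi hemb →+* B, ∀ s, ψ (D.inSym hemb s) = p s :=
  ⟨D.liftAluffi hemb p (Ideal.Quotient.lift D.reesIdeal (p.comp (symMap φ (D.res hemb))) h)
    fun _ => rfl, D.liftAluffi_inSym hemb _ _ _⟩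

section pullback

variable {S : Type u} {ι : Type} [CommRing S] [Fintype ι] (b : Module.Basis ι R D.amb)
  {ψ : S →+* A} {f : S →+* R} (hf : ∀ s, φ (f s) = ψ s)

include hf in
theorem piSemilinear_π_basis (a : ι → S) :
    piSemilinear ψ (fun i => D.π (b i)) a = D.π (∑ i, f (a i) • b i) := by
  simp only [piSemilinear_apply, map_sum, LinearMap.map_smulₛₗ, hf]

include hf in
theorem piSemilinear_π_basis_eq_zero_iff (a : ι → S) :
    piSemilinear ψ (fun i => D.π (b i)) a = 0 ↔
      a ∈ RingHom.ker ψ • (⊤ : Submodule S (ι → S)) := by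
  rw [D.piSemilinear_π_basis b hf, D.π_compatible, b.mem_ideal_smul_top_iff,
    (Pi.basisFun S ι).mem_ideal_smul_top_iff]
  simp only [b.repr_sum_self, Pi.basisFun_repr, RingHom.mem_ker, hf]

theorem piSemilinear_π_basis_surjective (hψ : Function.Surjective ψ) :
    Function.Surjective (piSemilinear ψ fun i => D.π (b i)) := fun y => by
  obtain ⟨x, rfl⟩ := D.π_surjective y
  choose a ha using fun i => hψ (φ (b.repr x i))
  refine ⟨a, ?_⟩
  conv_rhs => rw [← b.sum_repr x]
  simp only [piSemilinear_apply, ha, map_sum, LinearMap.map_smulₛₗ]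

/-- The pullback of a deformation to `R` along a homomorphism `f : S → R` over `A`. -/
def pullback [IsNoetherianRing S] [Nontrivial S] (hψ : Function.Surjective ψ)
    (hι : Fintype.card ι = Module.finrank A F) : Deformation ψ emb where
  amb := ι → S
  rank_eq := by rw [Module.finrank_fintype_fun_eq_card, hι]
  π := piSemilinear ψ fun i => D.π (b i)
  π_surjective := D.piSemilinear_π_basis_surjective b hψ
  π_compatible := D.piSemilinear_π_basis_eq_zero_iff b hf
  sub := (LinearMap.range emb).comap (piSemilinear ψ fun i => D.π (b i))
  sub_fg := IsNoetherian.noetherian _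
  smul_le := fun a ha => by
    rw [Submodule.mem_comap, (D.piSemilinear_π_basis_eq_zero_iff b hf a).mpr ha]
    exact zero_mem _
  image_sub := by
    rw [Submodule.comap_coe, Set.image_preimage_eq _ (D.piSemilinear_π_basis_surjective b hψ),
      LinearMap.coe_range]

end pullback

end Deformation

/-! ### Domination by polynomial rings and the inverse limit. -/

namespace Ambient

variable {A : Type u} [CommRing A] {E : Type v} [AddCommGroup E] [Module A E]
  {F : Type w} [AddCommGroup F] [Module A F]
  {k : Type u} [Field k] [Algebra k A] {emb : (E ⧸ Submodule.torsion A E) →ₗ[A] F}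

/-- Two finitely generated algebras over `A` are covered by a common polynomial ring over `A`. -/
theorem exists_mvPolynomial_surjective (X Y : Ambient k emb) :
    ∃ (n : ℕ) (f : MvPolynomial (Fin n) k →ₐ[k] X.R) (g : MvPolynomial (Fin n) k →ₐ[k] Y.R),
      Function.Surjective f ∧ Function.Surjective g ∧ ∀ p, X.φ (f p) = Y.φ (g p) := by
  obtain ⟨n, f, hf⟩ := Algebra.FiniteType.iff_quotient_mvPolynomial''.mp X.finiteType
  obtain ⟨m, g, hg⟩ := Algebra.FiniteType.iff_quotient_mvPolynomial''.mp Y.finiteType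
  choose x hx using fun j => X.φ_surjective (Y.φ (g (MvPolynomial.X j)))
  choose y hy using fun i => Y.φ_surjective (X.φ (f (MvPolynomial.X i)))
  -- Each variable goes to its own generator in one algebra and to a lift of that generator's image
  -- in A in the other. Surjectivity survives because `f'` and `g'` restrict to `f` and `g`.
  let f' : MvPolynomial (Fin n ⊕ Fin m) k →ₐ[k] X.R :=
    MvPolynomial.aeval (Sum.elim (fun i => f (MvPolynomial.X i)) x)
  let g' : MvPolynomial (Fin n ⊕ Fin m) k →ₐ[k] Y.R :=
    MvPolynomial.aeval (Sum.elim y fun j => g (MvPolynomial.X j))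
  let e := MvPolynomial.renameEquiv k (finSumFinEquiv (m := n) (n := m)).symm
  have hf' : f'.comp (MvPolynomial.rename Sum.inl) = f :=
    MvPolynomial.algHom_ext fun i => by simp [f']
  have hg' : g'.comp (MvPolynomial.rename Sum.inr) = g :=
    MvPolynomial.algHom_ext fun i => by simp [g']
  have hfg : X.φ.comp f' = Y.φ.comp g' := MvPolynomial.algHom_ext fun i => by
    rcases i with i | j
    · simp [f', g', hy]
    · simp [f', g', hx]
  refine ⟨n + m, f'.comp e.toAlgHom, g'.comp e.toAlgHom, ?_, ?_,
    fun p => DFunLike.congr_fun hfg (e p)⟩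
  · refine Function.Surjective.comp (g := f') (fun r => ?_) e.surjective
    obtain ⟨p, rfl⟩ := hf r
    exact ⟨_, DFunLike.congr_fun hf' p⟩
  · refine Function.Surjective.comp (g := g') (fun r => ?_) e.surjective
    obtain ⟨p, rfl⟩ := hg r
    exact ⟨_, DFunLike.congr_fun hg' p⟩

/-- Two ambient data are dominated by a smooth one, with a map to the first one which sends a basis
to a basis. -/
theorem exists_smooth_hom [Nontrivial A] (X Y : Ambient k emb) :
    ∃ (Z : Ambient k emb) (ι : Type) (_ : Fintype ι) (tX : Hom Z X) (_ : Hom Z Y)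
      (b : Module.Basis ι Z.R Z.D.amb) (c : Module.Basis ι X.R X.D.amb),
      Algebra.Smooth k Z.R ∧ ∀ i, tX.g (b i) = c i := by
  obtain ⟨n, f, g, hf, hg, hfg⟩ := exists_mvPolynomial_surjective X Y
  have : Nontrivial X.R := X.φ_surjective.nontrivial
  let c := Module.finBasis X.R X.D.amb
  -- Towards Y only lifts of the images of the basis in F are needed; `y` need not be a basis.
  choose y hy using fun i => Y.D.π_surjective (X.D.π (c i))
  let Z : Ambient k emb :=
    { R := MvPolynomial (Fin n) k
      finiteType := inferInstance
      φ := X.φ.comp f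
      φ_surjective := X.φ_surjective.comp hf
      D := X.D.pullback c (f := (f : MvPolynomial (Fin n) k →+* X.R)) (fun _ => rfl)
        (X.φ_surjective.comp hf) (by rw [Fintype.card_fin, X.D.rank_eq]) }
  have hZ (a : Fin (Module.finrank X.R X.D.amb) → MvPolynomial (Fin n) k) :
      X.D.π (piSemilinear (f : MvPolynomial (Fin n) k →+* X.R) c a) = Z.D.π a :=
    (X.D.piSemilinear_π_basis c (f := (f : MvPolynomial (Fin n) k →+* X.R))
      (fun _ => rfl) a).symm
  have hZ' (a : Fin (Module.finrank X.R X.D.amb) → MvPolynomial (Fin n) k) :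
      Y.D.π (piSemilinear (g : MvPolynomial (Fin n) k →+* Y.R) y a) = Z.D.π a := by
    rw [← hZ]
    simp only [piSemilinear_apply, map_sum, LinearMap.map_smulₛₗ, hy, RingHom.coe_coe, hfg]
  let tX : Hom Z X :=
    { f := f
      f_surjective := hf
      f_comp := fun _ => rfl
      g := piSemilinear (f : MvPolynomial (Fin n) k →+* X.R) c
      g_comp := hZ
      g_mem := fun a ha => by
        rw [X.D.mem_sub_iff]
        exact (congrArg (· ∈ Set.range emb) (hZ a)).mpr ((Z.D.mem_sub_iff a).mp ha) }
  let tY : Hom Z Y :=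
    { f := g
      f_surjective := hg
      f_comp := fun p => (hfg p).symm
      g := piSemilinear (g : MvPolynomial (Fin n) k →+* Y.R) y
      g_comp := hZ'
      g_mem := fun a ha => by
        rw [Y.D.mem_sub_iff]
        exact (congrArg (· ∈ Set.range emb) (hZ' a)).mpr ((Z.D.mem_sub_iff a).mp ha) }
  refine ⟨Z, _, inferInstance, tX, tY, Pi.basisFun (MvPolynomial (Fin n) k) _, c, ?_, fun i => ?_⟩
  · change Algebra.Smooth k (MvPolynomial (Fin n) k)
    exact ⟨inferInstance, inferInstance⟩
  · exact piSemilinear_basisFun (f : MvPolynomial (Fin n) k →+* X.R) c i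

variable (hemb : Function.Injective emb)

/-- The transition maps are maps between quotients of the same ring Sym_A(E/τ(E)), so each of its
elements gives a compatible family. -/
theorem Hom.aluffiMap_inSym {X Y : Ambient k emb} (t : Hom X Y) (s) :
    t.aluffiMap hemb (X.D.inSym hemb s) = Y.D.inSym hemb s :=
  X.D.liftAluffi_inSym hemb (Y.D.inSym hemb) ((Y.D.inRees hemb).comp t.reesMap) (fun x => by
    rw [← t.symMap_res_subMap hemb, Y.D.inSym_symMap hemb]
    rfl) s

/-- A smooth ambient datum and any other one are dominated by a smooth one whose embedded Aluffi
algebra is that of the first. -/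
theorem exists_smooth_dominating [Nontrivial A] (X Y : Ambient k emb)
    [Algebra.FormallySmooth k X.R] :
    ∃ (Z : Ambient k emb) (tX : Hom Z X) (_ : Hom Z Y), Algebra.Smooth k Z.R ∧
      Function.Injective (tX.aluffiMap hemb) := by
  obtain ⟨Z, ι, _, tX, tY, b, c, hZ, hbc⟩ := exists_smooth_hom X Y
  refine ⟨Z, tX, tY, hZ, ?_⟩
  obtain ⟨ψ, hψ⟩ := X.D.exists_hom_inSym hemb (Z.D.inSym hemb) fun s hs => by
    obtain ⟨s', hs', h⟩ := tX.exists_mem_reesIdeal b c hemb hbc hs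
    rw [← h, Z.D.inSym_symMap, Ideal.Quotient.eq_zero_iff_mem.mpr hs', map_zero]
  -- `ψ` exists because the equations of X vanish in the Aluffi algebra of Z; it undoes the
  -- transition map on the generating copy of Sym_A(E/τ(E)).
  refine Function.LeftInverse.injective (g := ψ) fun z => ?_
  obtain ⟨s, rfl⟩ := Z.D.inSym_surjective hemb z
  rw [tX.aluffiMap_inSym, hψ]

/-- The inverse limit of the embedded Aluffi algebras over a full subsystem which contains the
smooth ambient data is attained at each smooth ambient datum. -/
theorem limitAluffi.proj_bijective (P : Ambient k emb → Prop)
    (hP : ∀ Z : Ambient k emb, Algebra.Smooth k Z.R → P Z) (X : Ambient k emb)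
    [Algebra.FormallySmooth k X.R] (hX : P X) :
    Function.Bijective (limitAluffi.proj hemb P X hX) := by
  refine ⟨fun a a' h => Subtype.ext (funext fun Y => ?_), fun x => ?_⟩
  · rcases subsingleton_or_nontrivial A with hA | hA
    · exact (Algebra.subsingleton A (Y.1.D.EmbeddedAluffi hemb)).elim _ _
    obtain ⟨Z, tX, tY, hZ, hinj⟩ := exists_smooth_dominating hemb X Y.1
    have hZa : a.1 ⟨Z, hP Z hZ⟩ = a'.1 ⟨Z, hP Z hZ⟩ := by
      apply hinj
      rw [a.2 ⟨Z, hP Z hZ⟩ ⟨X, hX⟩ tX, a'.2 ⟨Z, hP Z hZ⟩ ⟨X, hX⟩ tX]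
      exact h
    rw [← a.2 ⟨Z, hP Z hZ⟩ Y tY, ← a'.2 ⟨Z, hP Z hZ⟩ Y tY, hZa]
  · obtain ⟨s, rfl⟩ := X.D.inSym_surjective hemb x
    exact ⟨⟨fun Y => Y.1.D.inSym hemb s, fun _ _ t => t.aluffiMap_inSym hemb s⟩, rfl⟩

end Ambient

/-- Over a reduced Noetherian ring, the equations of the Rees algebra of a deformation are the
torsion of its symmetric algebra. -/
theorem Deformation.reesIdeal_eq_torsion {A : Type u} [CommRing A] {E : Type v} [AddCommGroup E]
    [Module A E] {F : Type w} [AddCommGroup F] [Module A F] {R : Type u} [CommRing R]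
    [IsReduced R] [IsNoetherianRing R] {φ : R →+* A}
    {emb : (E ⧸ Submodule.torsion A E) →ₗ[A] F} (D : Deformation φ emb) :
    D.reesIdeal.restrictScalars R = Submodule.torsion R D.Sym :=
  le_antisymm (fun t ht => ker_symMap_subtype_le_torsion D.sub t ht)
    fun t ht => symMap_subtype_eq_zero_of_mem_torsion D.sub t ht

end

theorem theorem2p5 {k : Type u} [Field k] [PerfectField k]
    {A : Type u} [CommRing A] [Algebra k A] [Algebra.FiniteType k A]
    {E : Type v} [AddCommGroup E] [Module A E] [Module.Finite A E]
    {F : Type w} [AddCommGroup F] [Module A F] [Module.Free A F] [Module.Finite A F]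
    (emb : (E ⧸ Submodule.torsion A E) →ₗ[A] F) (hemb : Function.Injective emb)
    (X : Ambient k emb) (hX : Algebra.Smooth k X.R) :
    X.D.reesIdeal.restrictScalars X.R = Submodule.torsion X.R X.D.Sym ∧
    Function.Bijective (Ambient.limitAluffi.proj hemb (fun _ => True) X trivial) ∧
    Function.Bijective
      (Ambient.limitAluffi.proj hemb (fun Y => Algebra.Smooth k Y.R) X hX) := by
  have : IsReduced X.R := isReduced_of_smooth_of_field k X.R
  have : IsNoetherianRing X.R := @Algebra.FiniteType.isNoetherianRing k X.R _ _ _ X.finiteType _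
  exact ⟨X.D.reesIdeal_eq_torsion,
    Ambient.limitAluffi.proj_bijective hemb _ (fun _ _ => trivial) X trivial,
    Ambient.limitAluffi.proj_bijective hemb _ (fun _ h => h) X hX⟩
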